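/- Theorem 3.2. There is an absolute constant $\gamma_0>0$ such that $\mathscr{M}_8(\Sigma)>\gamma_0$ for every admissible surface $\Sigma\subset\mathbb{R}^3$. Here $\mathcal{H}^2$ is two-dimensional Hausdorff measure (normalized to agree with Lebesgue measure on planes), $B(x,r)$ is the closed ball, and for $p>0$ $$\mathscr{M}_p(\Sigma)=\int_{\Sigma}\int_{\Sigma}\int_{\Sigma}\int_{\Sigma}\mathcal{K}(T)^p\,d\mathcal{H}^2(x_0)\,d\mathcal{H}^2(x_1)\,d\mathcal{H}^2(x_2)\,d\mathcal{H}^2(x_3)\in[0,\infty],\qquad T=(x_0,x_1,x_2,x_3),$$ where $\mathcal{K}(T)=\dfrac{V(T)}{A(T)\,(\operatorname{diam}T)^2}$ if the four points are not coplanar and $\mathcal{K}(T)=0$ otherwise; $V(T)$ is the volume of the tetrahedron with vertices $x_0,\dots,x_3$ and $A(T)$ is the sum of the areas of its four triangular faces. A compact connected set $\Sigma\subset\mathbb{R}^3$ is called an admissible surface if $\Sigma=\partial U$ for some bounded domain (non-empty connected open set) $U\subset\mathbb{R}^3$ such that: (i) there is a constant $K=K(\Sigma)>0$ with $\infty>\mathcal{H}^2(\Sigma\cap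 B(x,r))\ge K^{-1}r^2$ for all $x\in\Sigma$ and all $0<r\le\operatorname{diam}\Sigma$; (ii) there is a dense subset $\Sigma^*\subset\Sigma$ such that for every $x\in\Sigma^*$ there are a unit vector $v$ and a radius $\delta_0>0$ with $$B(x,\delta_0)\cap\bigl(x+C^+\bigr)\subset U\cup\{x\},\qquad B(x,\delta_0)\cap\bigl(x+C^-\bigr)\subset(\mathbb{R}^3\setminus\overline{U})\cup\{x\},$$ where $C^{\pm}=\{y\in\mathbb{R}^3:\ \pm\, y\cdot v\ge|y|\cos(\pi/4)\}$. -/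

import Mathlib

open scoped MeasureTheory RealInnerProductSpace Pointwise

noncomputable section

namespace MengerSurface

/-- Euclidean three-space. -/
abbrev E3 : Type := EuclideanSpace ℝ (Fin 3)

/-- The cross product on Euclidean three-space. -/
def cross (u v : E3) : E3 := WithLp.toLp 2 (crossProduct (WithLp.ofLp u) (WithLp.ofLp v))

/-- The area of the (possibly degenerate) triangle with vertices `x`, `y`, `z`. -/
def triangleArea (x y z : E3) : ℝ := ‖cross (y - x) (z - x)‖ / 2

/-- The volume of the (possibly degenerate) tetrahedron with vertices `T 0, …, T 3`. -/
def tetraVolume (T : Fin 4 → E3) : ℝ :=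
  |⟪T 3 - T 0, cross (T 1 - T 0) (T 2 - T 0)⟫| / 6

/-- The total area of a tetrahedron: the sum of the areas of its four triangular faces. -/
def tetraArea (T : Fin 4 → E3) : ℝ :=
  triangleArea (T 0) (T 1) (T 2) + triangleArea (T 0) (T 1) (T 3) +
    triangleArea (T 0) (T 2) (T 3) + triangleArea (T 1) (T 2) (T 3)

open Classical in
/-- The four-point curvature integrand `V(T) / (A(T) (diam T)²)`, set to `0` when the four
vertices are coplanar. -/
def curv (T : Fin 4 → E3) : ℝ :=
  if Coplanar ℝ (Set.range T) then 0
  else tetraVolume T / (tetraArea T * Metric.diam (Set.range T) ^ 2)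

/-- The integral Menger curvature of `S`: the integral of `curv ^ p` over `S⁴` with respect to
the fourfold product of the two-dimensional Hausdorff measure on `S` (normalized so as to agree
with Lebesgue measure on planes). Its value is in `[0, ∞]`. -/
def mengerEnergy (p : ℝ) (S : Set E3) : ENNReal :=
  ∫⁻ T : Fin 4 → E3, ENNReal.ofReal (curv T ^ p)
    ∂(MeasureTheory.Measure.pi fun _ : Fin 4 => (μHE[2] : MeasureTheory.Measure E3).restrict S)

/-- The half-cone with vertex `0`, axis `w` and opening angle `2 φ`. -/
def conePlus (φ : ℝ) (w : E3) : Set E3 := {y | ‖y‖ * Real.cos φ ≤ ⟪y, w⟫}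

/-- The half-cone opposite to `conePlus φ w`. -/
def coneMinus (φ : ℝ) (w : E3) : Set E3 := {y | ‖y‖ * Real.cos φ ≤ -⟪y, w⟫}

/-- Lower Ahlfors regularity: there is `K > 0` such that
`∞ > H²(S ∩ B(x,r)) ≥ r² / K` for all `x ∈ S` and `0 < r ≤ diam S`. -/
def LowerRegular (S : Set E3) : Prop :=
  ∃ K : ℝ, 0 < K ∧ ∀ x ∈ S, ∀ r : ℝ, 0 < r → r ≤ Metric.diam S →
    μHE[2] (S ∩ Metric.closedBall x r) < ⊤ ∧
      ENNReal.ofReal (K⁻¹ * r ^ 2) ≤ μHE[2] (S ∩ Metric.closedBall x r)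

/-- Two-sided cone condition on a dense subset `D` of `S`: at each `x ∈ D` small opposite
half-cones of half-angle `π/4` lie in `U` and in the complement of its closure. -/
def DenseConeCondition (S U : Set E3) : Prop :=
  ∃ D : Set E3, D ⊆ S ∧ S ⊆ closure D ∧ ∀ x ∈ D, ∃ v : E3, ‖v‖ = 1 ∧ ∃ δ : ℝ, 0 < δ ∧
    Metric.closedBall x δ ∩ (x +ᵥ conePlus (Real.pi / 4) v) ⊆ U ∪ {x} ∧
    Metric.closedBall x δ ∩ (x +ᵥ coneMinus (Real.pi / 4) v) ⊆ (closure U)ᶜ ∪ {x}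

/-- Admissible surfaces: compact connected sets that bound a bounded domain `U`, are lower
Ahlfors regular, and satisfy the dense two-sided cone condition with respect to `U`. -/
def IsAdmissible (S : Set E3) : Prop :=
  IsCompact S ∧ IsConnected S ∧
    ∃ U : Set E3, IsOpen U ∧ IsConnected U ∧ Bornology.IsBounded U ∧ S = frontier U ∧
      LowerRegular S ∧ DenseConeCondition S U

end MengerSurface

end

/-! Fix a point `x` of the dense set. The cones separate `U` from its exterior at small scales about
`x`. If all triple products of boundary points at twice a separated scale are small, the boundary
there lies in a thin slab (`exists_slab`), and separation passes to the doubled scale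
(`Separated.double`). Separation also forces area, by projection to a plane
(`Separated.le_measure`). Since `U` is bounded, doubling must stop. It stops at a scale `d` carrying
a fat tetrahedron with vertex `x`, with absolute area bounds about `x` up to `d`
(`exists_isGoodScale`).

Take a nearly smallest good scale `d`. The vertices of its tetrahedron are close to dense points
whose own good scales are at least `d / 2`, so area of order `d ^ 2` surrounds each vertex with an
absolute constant. The curvature there is at least of order `1 / d`, and `d ^ (-8) * (d ^ 2) ^ 4` is
scale-free (`le_mengerEnergy`). If fat tetrahedra occur at arbitrarily small scales, there may be no
such minimum; then regularity, with its non-absolute constant, contradicts absolute continuity of a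
finite energy (`mengerEnergy_eq_top`). -/

noncomputable section

namespace MengerSurface

/-! ### Triple products and slabs -/

/-- The triple product, six times the signed volume of the tetrahedron `0, u, v, w`. -/
def triple (u v w : E3) : ℝ := ⟪w, cross u v⟫

lemma inner_eq_coords (u v : E3) : ⟪u, v⟫ = u 0 * v 0 + u 1 * v 1 + u 2 * v 2 := by
  simp [PiLp.inner_apply, Fin.sum_univ_three, mul_comm]

lemma cross_zero_coord (u v : E3) : cross u v 0 = u 1 * v 2 - u 2 * v 1 := by
  simp [cross, cross_apply]

lemma cross_one_coord (u v : E3) : cross u v 1 = u 2 * v 0 - u 0 * v 2 := by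
  simp [cross, cross_apply]

lemma cross_two_coord (u v : E3) : cross u v 2 = u 0 * v 1 - u 1 * v 0 := by
  simp [cross, cross_apply]

lemma inner_cross_cross (a b c d : E3) :
    ⟪cross a b, cross c d⟫ = ⟪a, c⟫ * ⟪b, d⟫ - ⟪a, d⟫ * ⟪b, c⟫ := by
  simp only [inner_eq_coords, cross_zero_coord, cross_one_coord, cross_two_coord]
  ring

lemma norm_cross_sq (u v : E3) : ‖cross u v‖ ^ 2 = ‖u‖ ^ 2 * ‖v‖ ^ 2 - ⟪u, v⟫ ^ 2 := by
  rw [← real_inner_self_eq_norm_sq, inner_cross_cross, real_inner_self_eq_norm_sq,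
    real_inner_self_eq_norm_sq, real_inner_comm u v]
  ring

lemma norm_cross_le (u v : E3) : ‖cross u v‖ ≤ ‖u‖ * ‖v‖ := by
  apply le_of_sq_le_sq _ (by positivity)
  rw [norm_cross_sq, mul_pow]
  nlinarith [sq_nonneg ⟪u, v⟫]

lemma abs_triple_le (u v w : E3) : |triple u v w| ≤ ‖u‖ * ‖v‖ * ‖w‖ := by
  refine (abs_real_inner_le_norm _ _).trans ?_
  rw [mul_comm]
  exact mul_le_mul_of_nonneg_right (norm_cross_le u v) (norm_nonneg w)

/-- Trilinearity, changing one argument at a time. -/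
lemma triple_sub_triple (u v w u' v' w' : E3) :
    triple u v w - triple u' v' w' =
      triple u v (w - w') + triple (u - u') v w' + triple u' (v - v') w' := by
  simp only [triple, inner_eq_coords, cross_zero_coord, cross_one_coord, cross_two_coord,
    PiLp.sub_apply]
  ring

/-- A quantitative perturbation estimate for the triple product. -/
lemma abs_triple_sub_triple_le {u v w u' v' w' : E3} {R s : ℝ} (hu : ‖u‖ ≤ R) (hv : ‖v‖ ≤ R)
    (hu' : ‖u'‖ ≤ R) (hw' : ‖w'‖ ≤ R) (hus : ‖u - u'‖ ≤ s) (hvs : ‖v - v'‖ ≤ s)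
    (hws : ‖w - w'‖ ≤ s) :
    |triple u v w - triple u' v' w'| ≤ 3 * R ^ 2 * s := by
  have hR : 0 ≤ R := (norm_nonneg _).trans hu
  have hs : 0 ≤ s := (norm_nonneg _).trans hus
  have h1 : |triple u v (w - w')| ≤ R * R * s := (abs_triple_le _ _ _).trans (by gcongr)
  have h2 : |triple (u - u') v w'| ≤ s * R * R := (abs_triple_le _ _ _).trans (by gcongr)
  have h3 : |triple u' (v - v') w'| ≤ R * s * R := (abs_triple_le _ _ _).trans (by gcongr)
  rw [triple_sub_triple]
  refine (abs_add_le _ _).trans ((add_le_add ((abs_add_le _ _).trans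
    (add_le_add h1 h2)) h3).trans_eq (by ring))

lemma exists_unit_orthogonal (a : E3) : ∃ n : E3, ‖n‖ = 1 ∧ ⟪a, n⟫ = 0 := by
  have h : (ℝ ∙ a)ᗮ ≠ ⊥ := by
    intro h
    have h1 := (ℝ ∙ a).finrank_add_finrank_orthogonal
    have h2 := finrank_span_le_card (R := ℝ) ({a} : Set E3)
    rw [h, finrank_bot, finrank_euclideanSpace_fin] at h1
    rw [Set.toFinset_singleton, Finset.card_singleton] at h2
    omega
  obtain ⟨m, hm, hm0⟩ := Submodule.exists_mem_ne_zero_of_ne_bot h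
  refine ⟨‖m‖⁻¹ • m, norm_smul_inv_norm hm0, ?_⟩
  rw [inner_smul_right, Submodule.mem_orthogonal_singleton_iff_inner_right.1 hm, mul_zero]

/-- A set of vectors all of whose triple products are smaller than `h ^ 3` lies in a slab of
half-width `h`. -/
lemma exists_slab (K : Set E3) {h : ℝ} (hh : 0 < h)
    (hK : ∀ a ∈ K, ∀ b ∈ K, ∀ c ∈ K, |triple a b c| < h ^ 3) :
    ∃ n : E3, ‖n‖ = 1 ∧ ∀ y ∈ K, |⟪y, n⟫| < h := by
  -- Greedy choice of a plane: all vectors short, all close to the line of a long `a`, or spanned by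
  -- `a` and `b` with large cross product. In the last case `n` is normal to `a` and `b`, and the
  -- triple product is `‖cross a b‖` times the height.
  by_cases h1 : ∀ y ∈ K, ‖y‖ < h
  · obtain ⟨n, hn, -⟩ := exists_unit_orthogonal 0
    refine ⟨n, hn, fun y hy => lt_of_le_of_lt (abs_real_inner_le_norm _ _) ?_⟩
    simpa [hn] using h1 y hy
  push Not at h1
  obtain ⟨a, haK, ha⟩ := h1
  have ha0 : 0 < ‖a‖ := hh.trans_le ha
  by_cases h2 : ∀ y ∈ K, ‖cross a y‖ < h * ‖a‖
  · obtain ⟨n, hn, hna⟩ := exists_unit_orthogonal a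
    refine ⟨n, hn, fun y hy => ?_⟩
    have e1 : ⟪cross a y, cross a n⟫ = ‖a‖ ^ 2 * ⟪y, n⟫ := by
      rw [inner_cross_cross, hna, real_inner_self_eq_norm_sq]; ring
    have e2 : ‖cross a n‖ ≤ ‖a‖ := by simpa [hn] using norm_cross_le a n
    have e3 : ‖a‖ ^ 2 * |⟪y, n⟫| ≤ ‖cross a y‖ * ‖a‖ := by
      rw [← abs_of_pos (pow_pos ha0 2), ← abs_mul, ← e1]
      exact (abs_real_inner_le_norm _ _).trans (by gcongr)
    have e4 : ‖a‖ ^ 2 * |⟪y, n⟫| < ‖a‖ ^ 2 * h := by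
      refine e3.trans_lt ?_
      have := mul_lt_mul_of_pos_right (h2 y hy) ha0
      linarith
    exact lt_of_mul_lt_mul_left e4 (by positivity)
  push Not at h2
  obtain ⟨b, hbK, hb⟩ := h2
  have hc : h ^ 2 ≤ ‖cross a b‖ := by nlinarith
  have hc0 : 0 < ‖cross a b‖ := by nlinarith
  refine ⟨‖cross a b‖⁻¹ • cross a b, norm_smul_inv_norm (norm_pos_iff.1 hc0), fun y hy => ?_⟩
  have e := hK a haK b hbK y hy
  rw [inner_smul_right, abs_mul, abs_of_pos (inv_pos.2 hc0), inv_mul_lt_iff₀ hc0]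
  exact e.trans_le (by nlinarith)

/-- The vertices of a tetrahedron with nonzero triple product are not coplanar. -/
lemma not_coplanar_of_triple_ne_zero {T : Fin 4 → E3}
    (h : triple (T 1 - T 0) (T 2 - T 0) (T 3 - T 0) ≠ 0) : ¬ Coplanar ℝ (Set.range T) := by
  intro hc
  have hli : LinearIndependent ℝ ![T 1 - T 0, T 2 - T 0, T 3 - T 0] := by
    rw [Fintype.linearIndependent_iff]
    intro g hg
    have hg' : g 0 • (T 1 - T 0) + g 1 • (T 2 - T 0) + g 2 • (T 3 - T 0) = 0 := by
      simpa [Fin.sum_univ_three] using hg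
    -- Cramer's rule: the combinations below use the cofactors.
    have key : ∀ a b c : E3, ∀ p q r : ℝ, p • a + q • b + r • c = 0 →
        p * triple a b c = 0 ∧ q * triple a b c = 0 ∧ r * triple a b c = 0 := by
      intro a b c p q r h0
      have h1 : ∀ i, p * a i + q * b i + r * c i = 0 := fun i => by
        simpa using congrArg (fun v : E3 => v i) h0
      have e0 := h1 0
      have e1 := h1 1
      have e2 := h1 2
      simp only [triple, inner_eq_coords, cross_zero_coord, cross_one_coord, cross_two_coord]
      refine ⟨?_, ?_, ?_⟩
      · linear_combination (b 1 * c 2 - b 2 * c 1) * e0 + (b 2 * c 0 - b 0 * c 2) * e1 +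
          (b 0 * c 1 - b 1 * c 0) * e2
      · linear_combination (c 1 * a 2 - c 2 * a 1) * e0 + (c 2 * a 0 - c 0 * a 2) * e1 +
          (c 0 * a 1 - c 1 * a 0) * e2
      · linear_combination (a 1 * b 2 - a 2 * b 1) * e0 + (a 2 * b 0 - a 0 * b 2) * e1 +
          (a 0 * b 1 - a 1 * b 0) * e2
    obtain ⟨k0, k1, k2⟩ := key _ _ _ _ _ _ hg'
    intro i
    fin_cases i
    · exact (mul_eq_zero.1 k0).resolve_right h
    · exact (mul_eq_zero.1 k1).resolve_right h
    · exact (mul_eq_zero.1 k2).resolve_right h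
  have hsub : Submodule.span ℝ (Set.range ![T 1 - T 0, T 2 - T 0, T 3 - T 0]) ≤
      vectorSpan ℝ (Set.range T) := by
    rw [Submodule.span_le]
    rintro _ ⟨i, rfl⟩
    fin_cases i <;>
      exact vsub_mem_vectorSpan ℝ (Set.mem_range_self _) (Set.mem_range_self _)
  have h3 := finrank_span_eq_card hli
  have h4 := Submodule.finrank_mono hsub
  have h5 := (coplanar_iff_finrank_le_two).1 hc
  simp only [Fintype.card_fin] at h3
  omega

/-! ### Separation and its propagation to larger scales -/

/-- The cap of the ball `B(x, r)` at height `h` over its centre in the direction `n`. -/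
def cap (x : E3) (r h : ℝ) (n : E3) : Set E3 :=
  {y | y ∈ Metric.closedBall x r ∧ h ≤ ⟪y - x, n⟫}

lemma convex_cap (x : E3) (r h : ℝ) (n : E3) : Convex ℝ (cap x r h n) := by
  refine (convex_closedBall x r).inter ?_
  intro y hy z hz a b ha hb hab
  change h ≤ ⟪y - x, n⟫ at hy
  change h ≤ ⟪z - x, n⟫ at hz
  change h ≤ ⟪a • y + b • z - x, n⟫
  have e : a • y + b • z - x = a • (y - x) + b • (z - x) := by
    obtain rfl : b = 1 - a := by linarith
    module
  rw [e, inner_add_left, real_inner_smul_left, real_inner_smul_left]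
  calc h = a * h + b * h := by rw [← add_mul, hab, one_mul]
    _ ≤ _ := by gcongr

lemma cap_anti {x n : E3} {r h h' : ℝ} (hh : h ≤ h') : cap x r h' n ⊆ cap x r h n :=
  fun _ hy => ⟨hy.1, hh.trans hy.2⟩

/-- The two caps of `B(x, r)` of opening angle `π/4` about the axis `n` lie on different sides of
the boundary of `U`. -/
def Separated (U : Set E3) (x : E3) (r : ℝ) (n : E3) : Prop :=
  cap x r (√2 / 2 * r) n ⊆ U ∧ cap x r (√2 / 2 * r) (-n) ⊆ (closure U)ᶜ

/-- A preconnected set that meets a set and its complement meets the frontier. -/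
lemma inter_frontier_nonempty {X : Type*} [TopologicalSpace X] {t s : Set X}
    (ht : IsPreconnected t) (h1 : (t ∩ s).Nonempty) (h2 : (t ∩ sᶜ).Nonempty) :
    (t ∩ frontier s).Nonempty := by
  by_contra hne
  have hd : ∀ y ∈ t, y ∉ frontier s := fun y hy hyf => hne ⟨y, hy, hyf⟩
  have hin : ∀ y ∈ t, y ∈ s → y ∈ interior s := fun y hy hys => by
    by_contra h
    exact hd y hy ⟨subset_closure hys, h⟩
  have hout : ∀ y ∈ t, y ∈ sᶜ → y ∈ (closure s)ᶜ := fun y hy hys h =>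
    hd y hy ⟨h, fun h' => hys (interior_subset h')⟩
  obtain ⟨y, hy, hys⟩ := h1
  obtain ⟨z, hz, hzs⟩ := h2
  obtain ⟨w, -, hw, hw'⟩ := ht (interior s) (closure s)ᶜ isOpen_interior isClosed_closure.isOpen_compl
    (fun w hw => (em (w ∈ s)).imp (hin w hw) (hout w hw)) ⟨y, hy, hin y hy hys⟩
    ⟨z, hz, hout z hz hzs⟩
  exact hw' (subset_closure (interior_subset hw))

/-- A convex set that misses the boundary of `U` lies in `U` as soon as it meets `U`. -/
lemma subset_of_disjoint_frontier {C U : Set E3} (hC : Convex ℝ C) (hd : Disjoint C (frontier U))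
    (hm : (C ∩ U).Nonempty) : C ⊆ U := by
  by_contra hne
  obtain ⟨y, hyC, hyU⟩ := Set.not_subset.1 hne
  obtain ⟨z, hzC, hz⟩ := inter_frontier_nonempty hC.isPreconnected hm ⟨y, hyC, hyU⟩
  exact Set.disjoint_left.1 hd hzC hz

/-- The exterior of `U` has its frontier inside that of `U`, so the previous lemma applies to it. -/
lemma subset_compl_closure_of_disjoint_frontier {C U : Set E3} (hC : Convex ℝ C)
    (hd : Disjoint C (frontier U)) (hm : (C ∩ (closure U)ᶜ).Nonempty) : C ⊆ (closure U)ᶜ := by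
  refine subset_of_disjoint_frontier hC (hd.mono_right ?_) hm
  rw [frontier_compl]
  exact frontier_closure_subset

/-- Opposite `π/4`-cones on different sides of the boundary separate at every small scale. -/
lemma separated_of_cones {U : Set E3} {x v : E3} {δ : ℝ}
    (hU : Metric.closedBall x δ ∩ (x +ᵥ conePlus (Real.pi / 4) v) ⊆ U ∪ {x})
    (hU' : Metric.closedBall x δ ∩ (x +ᵥ coneMinus (Real.pi / 4) v) ⊆ (closure U)ᶜ ∪ {x})
    {r : ℝ} (hr : 0 < r) (hrδ : r ≤ δ) : Separated U x r v := by
  have key : ∀ n y, y ∈ cap x r (√2 / 2 * r) n →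
      y ∈ Metric.closedBall x δ ∧ ‖y - x‖ * Real.cos (Real.pi / 4) ≤ ⟪y - x, n⟫ ∧ y ≠ x := by
    intro n y hy
    have h1 : ‖y - x‖ ≤ r := by simpa [dist_eq_norm] using hy.1
    refine ⟨Metric.closedBall_subset_closedBall hrδ hy.1, ?_, ?_⟩
    · rw [Real.cos_pi_div_four, mul_comm]
      exact le_trans (by gcongr) hy.2
    · rintro rfl
      have h2 := hy.2
      rw [sub_self, inner_zero_left] at h2
      have : 0 < √2 / 2 * r := by positivity
      linarith
  constructor
  · intro y hy
    obtain ⟨h1, h2, h3⟩ := key _ _ hy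
    refine (hU ⟨h1, ?_⟩).resolve_right h3
    rw [Set.mem_vadd_set_iff_neg_vadd_mem, vadd_eq_add, neg_add_eq_sub]
    exact h2
  · intro y hy
    obtain ⟨h1, h2, h3⟩ := key _ _ hy
    refine (hU' ⟨h1, ?_⟩).resolve_right h3
    rw [Set.mem_vadd_set_iff_neg_vadd_mem, vadd_eq_add, neg_add_eq_sub]
    rw [inner_neg_right] at h2
    exact h2

/-- Two directions at a non-obtuse angle have a common direction at angle at most `π/4` to both. -/
lemma exists_common_direction {n m : E3} (hn : ‖n‖ = 1) (hm : ‖m‖ = 1) (hnm : 0 ≤ ⟪n, m⟫) :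
    ∃ w : E3, ‖w‖ = 1 ∧ √2 / 2 ≤ ⟪w, n⟫ ∧ √2 / 2 ≤ ⟪w, m⟫ := by
  have hn' : ⟪n, n⟫ = 1 := by rw [real_inner_self_eq_norm_sq, hn, one_pow]
  have hm' : ⟪m, m⟫ = 1 := by rw [real_inner_self_eq_norm_sq, hm, one_pow]
  have hsq : ‖n + m‖ ^ 2 = 2 + 2 * ⟪n, m⟫ := by
    rw [norm_add_sq_real, hn, hm]; ring
  have h2 : √2 ≤ ‖n + m‖ := Real.sqrt_le_iff.2 ⟨norm_nonneg _, by linarith⟩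
  have hpos : 0 < ‖n + m‖ := (Real.sqrt_pos.2 two_pos).trans_le h2
  -- The bisector: its inner product with either vector is `‖n + m‖ / 2`.
  refine ⟨‖n + m‖⁻¹ • (n + m), norm_smul_inv_norm (norm_pos_iff.1 hpos), ?_, ?_⟩
  · rw [real_inner_smul_left, inner_add_left, hn', real_inner_comm n m, inv_mul_eq_div,
      le_div_iff₀ hpos]
    nlinarith
  · rw [real_inner_smul_left, inner_add_left, hm', inv_mul_eq_div, le_div_iff₀ hpos]
    nlinarith

/-- Separation passes from one scale to its double if the boundary is flat at the larger scale. -/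
lemma Separated.double {U : Set E3} {x n : E3} {r : ℝ} (hr : 0 < r) (hn : ‖n‖ = 1)
    (hsep : Separated U x r n)
    (hflat : ∀ a ∈ frontier U ∩ Metric.closedBall x (2 * r),
      ∀ b ∈ frontier U ∩ Metric.closedBall x (2 * r),
      ∀ c ∈ frontier U ∩ Metric.closedBall x (2 * r),
        |triple (a - x) (b - x) (c - x)| < (r / 2) ^ 3) :
    ∃ m : E3, ‖m‖ = 1 ∧ Separated U x (2 * r) m := by
  obtain ⟨m, hm, hmK⟩ := exists_slab
    ((fun y => y - x) '' (frontier U ∩ Metric.closedBall x (2 * r))) (half_pos hr) (by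
      rintro _ ⟨a, ha, rfl⟩ _ ⟨b, hb, rfl⟩ _ ⟨c, hc, rfl⟩
      exact hflat a ha b hb c hc)
  have hslab : ∀ y ∈ frontier U, y ∈ Metric.closedBall x (2 * r) → |⟪y - x, m⟫| < r / 2 :=
    fun y hy hyb => hmK _ ⟨y, ⟨hy, hyb⟩, rfl⟩
  clear hmK hflat
  have hsqrt : 1 ≤ √2 := Real.one_le_sqrt.2 one_le_two
  -- The slab determines its normal only up to sign.
  wlog hnm : 0 ≤ ⟪n, m⟫ generalizing m
  · refine this (-m) (by rwa [norm_neg]) (fun y hy hyb => ?_) ?_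
    · rw [inner_neg_right, abs_neg]; exact hslab y hy hyb
    · rw [inner_neg_right]; linarith
  obtain ⟨w, hw, hwn, hwm⟩ := exists_common_direction hn hm hnm
  have hball : ∀ s : ℝ, |s| = r → ∀ R, r ≤ R → x + s • w ∈ Metric.closedBall x R := by
    intro s hs R hR
    rw [mem_closedBall_iff_norm, add_sub_cancel_left, norm_smul, hw, mul_one, Real.norm_eq_abs, hs]
    exact hR
  have hle : √2 / 2 * (2 * r) ≥ r / 2 := by nlinarith
  have hr2 : r / 2 ≤ √2 / 2 * r := by nlinarith
  -- The convex caps beyond height `r / 2` miss the boundary. The points `x ± r • w` lie in them and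
  -- in the old caps, so they tell which side each new cap is on.
  refine ⟨m, hm, (cap_anti hle).trans (subset_of_disjoint_frontier (convex_cap _ _ _ _) ?_
    ⟨x + r • w, ⟨hball r (abs_of_pos hr) _ (by linarith), ?_⟩,
      hsep.1 ⟨hball r (abs_of_pos hr) _ le_rfl, ?_⟩⟩),
    (cap_anti hle).trans (subset_compl_closure_of_disjoint_frontier (convex_cap _ _ _ _) ?_
    ⟨x + (-r) • w, ⟨hball (-r) (by rw [abs_neg, abs_of_pos hr]) _ (by linarith), ?_⟩,
      hsep.2 ⟨hball (-r) (by rw [abs_neg, abs_of_pos hr]) _ le_rfl, ?_⟩⟩)⟩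
  · refine Set.disjoint_left.2 fun y hy hyU => ?_
    have := hslab y hyU hy.1
    exact absurd hy.2 (not_le.2 ((le_abs_self _).trans_lt this))
  · rw [add_sub_cancel_left, real_inner_smul_left]
    nlinarith
  · rw [add_sub_cancel_left, real_inner_smul_left]
    nlinarith
  · refine Set.disjoint_left.2 fun y hy hyU => ?_
    have h1 := hslab y hyU hy.1
    have h2 := hy.2
    rw [inner_neg_right] at h2
    linarith [neg_abs_le ⟪y - x, m⟫]
  · rw [add_sub_cancel_left, real_inner_smul_left, inner_neg_right]
    nlinarith
  · rw [add_sub_cancel_left, real_inner_smul_left, inner_neg_right]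
    nlinarith

/-- A bounded set is not separated at large scales. -/
lemma Separated.le_of_subset_closedBall {U : Set E3} {x n : E3} {r R : ℝ} (hr : 0 ≤ r)
    (hn : ‖n‖ = 1) (hsep : Separated U x r n) (hU : U ⊆ Metric.closedBall x R) : r ≤ R := by
  have h : x + r • n ∈ U := by
    apply hsep.1
    refine ⟨?_, ?_⟩
    · simp [hn, norm_smul, abs_of_nonneg hr]
    · rw [add_sub_cancel_left, real_inner_smul_left, real_inner_self_eq_norm_sq, hn]
      have : √2 ≤ 2 := Real.sqrt_le_iff.2 ⟨by norm_num, by norm_num⟩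
      nlinarith
  simpa [hn, norm_smul, abs_of_nonneg hr] using hU h

/-! ### Area at a separated scale -/

/-- Non-expanding maps do not increase the Euclidean Hausdorff measure. -/
lemma euclideanHausdorffMeasure_image_le {X Y : Type*} [EMetricSpace X] [MeasurableSpace X]
    [BorelSpace X] [EMetricSpace Y] [MeasurableSpace Y] [BorelSpace Y] {f : X → Y}
    (hf : LipschitzWith 1 f) (d : ℕ) (s : Set X) :
    (μHE[d] : MeasureTheory.Measure Y) (f '' s) ≤ (μHE[d] : MeasureTheory.Measure X) s := by
  simp only [MeasureTheory.Measure.euclideanHausdorffMeasure_def, MeasureTheory.Measure.smul_apply]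
  gcongr
  simpa using hf.hausdorffMeasure_image_le (Nat.cast_nonneg d) s

/-- At a separated scale the boundary has at least the area of a disc of half the radius. -/
lemma Separated.le_measure {U : Set E3} {x n : E3} {r : ℝ} (hr : 0 < r) (hn : ‖n‖ = 1)
    (hsep : Separated U x r n) :
    ENNReal.ofReal (r ^ 2 / 4) ≤ μHE[2] (frontier U ∩ Metric.closedBall x r) := by
  have hfr : Fact (Module.finrank ℝ E3 = 2 + 1) := ⟨by simp⟩
  have hn0 : n ≠ 0 := by rintro rfl; simp at hn
  have hrank : Module.finrank ℝ (ℝ ∙ n)ᗮ = 2 := Submodule.finrank_orthogonal_span_singleton hn0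
  let b := (stdOrthonormalBasis ℝ (ℝ ∙ n)ᗮ).reindex (finCongr hrank)
  let f : E3 → EuclideanSpace ℝ (Fin 2) :=
    fun y => b.repr ((ℝ ∙ n)ᗮ.orthogonalProjectionOnto (y - x))
  have hf : LipschitzWith 1 f := by
    refine LipschitzWith.of_dist_le_mul fun y z => ?_
    simp only [f, NNReal.coe_one, one_mul]
    rw [LinearIsometryEquiv.dist_map, dist_eq_norm, ← map_sub, sub_sub_sub_cancel_right,
      dist_eq_norm]
    exact Submodule.norm_orthogonalProjectionOnto_apply_le _ _
  have hs2 : (√2) ^ 2 = 2 := Real.sq_sqrt zero_le_two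
  -- Over each point of the disc, the segment parallel to `n` runs from one cap to the other and so
  -- meets the frontier. It stays in the ball because `r ^ 2 / 4 + r ^ 2 / 2 ≤ r ^ 2`.
  have hball : Metric.closedBall 0 (r / 2) ⊆ f '' (frontier U ∩ Metric.closedBall x r) := by
    intro y hy
    have hy' : ‖y‖ ≤ r / 2 := by simpa using hy
    set p := b.repr.symm y with hp
    have hpn : ⟪(p : E3), n⟫ = 0 := by
      rw [real_inner_comm]
      exact Submodule.mem_orthogonal_singleton_iff_inner_right.1 p.2
    have hpnorm : ‖(p : E3)‖ = ‖y‖ := by rw [← Submodule.coe_norm, hp, LinearIsometryEquiv.norm_map]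
    have hmem : ∀ t : ℝ, t ^ 2 ≤ r ^ 2 / 2 → x + (p + t • n) ∈ Metric.closedBall x r := by
      intro t ht
      rw [mem_closedBall_iff_norm, add_sub_cancel_left]
      apply le_of_sq_le_sq _ hr.le
      rw [norm_add_sq_real, real_inner_smul_right, hpn, norm_smul, hn, hpnorm, mul_one,
        Real.norm_eq_abs, sq_abs]
      nlinarith [norm_nonneg y]
    have hin : ∀ t : ℝ, ⟪x + (p + t • n) - x, n⟫ = t := by
      intro t
      rw [add_sub_cancel_left, inner_add_left, hpn, real_inner_smul_left,
        real_inner_self_eq_norm_sq, hn]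
      ring
    let γ : ℝ → E3 := fun t => x + (p + t • n)
    have hγ : Continuous γ := by fun_prop
    have hI : IsPreconnected (γ '' Set.Icc (-(√2 / 2 * r)) (√2 / 2 * r)) :=
      isPreconnected_Icc.image _ hγ.continuousOn
    have hpos : 0 < √2 / 2 * r := by positivity
    have hκ : (√2 / 2 * r) ^ 2 = r ^ 2 / 2 := by rw [mul_pow, div_pow, hs2]; ring
    obtain ⟨z, ⟨t, ht, rfl⟩, hzU⟩ := inter_frontier_nonempty (s := U) hI
      ⟨γ (√2 / 2 * r), ⟨_, ⟨by linarith, le_rfl⟩, rfl⟩,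
        hsep.1 ⟨hmem _ hκ.le, (hin _).ge⟩⟩
      ⟨γ (-(√2 / 2 * r)), ⟨_, ⟨le_rfl, by linarith⟩, rfl⟩,
        fun hmemU => hsep.2 ⟨hmem _ (by rw [neg_sq, hκ]), by
          rw [inner_neg_right, hin, neg_neg]⟩ (subset_closure hmemU)⟩
    refine ⟨γ t, ⟨hzU, hmem t ?_⟩, ?_⟩
    · rw [← hκ]; exact sq_le_sq' ht.1 ht.2
    · simp only [f, γ]
      have hzero : (ℝ ∙ n)ᗮ.orthogonalProjectionOnto (t • n) = 0 := by
        rw [map_smul, Submodule.orthogonalProjectionOnto_orthogonalComplement_singleton_eq_zero,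
          smul_zero]
      rw [add_sub_cancel_left, map_add, hzero, add_zero,
        Submodule.orthogonalProjectionOnto_mem_subspace_eq_self, hp, LinearIsometryEquiv.apply_symm_apply]
  calc ENNReal.ofReal (r ^ 2 / 4)
      ≤ MeasureTheory.volume (Metric.closedBall (0 : EuclideanSpace ℝ (Fin 2)) (r / 2)) := by
        rw [EuclideanSpace.volume_closedBall_fin_two, ← ENNReal.ofReal_pow (by positivity),
          ← ENNReal.ofReal_mul (by positivity)]
        apply ENNReal.ofReal_le_ofReal
        nlinarith [Real.pi_gt_three, sq_nonneg r]
    _ = μHE[2] (Metric.closedBall (0 : EuclideanSpace ℝ (Fin 2)) (r / 2)) := by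
        rw [EuclideanSpace.euclideanHausdorffMeasure_eq_volume]
    _ ≤ μHE[2] (f '' (frontier U ∩ Metric.closedBall x r)) := MeasureTheory.measure_mono hball
    _ ≤ _ := euclideanHausdorffMeasure_image_le hf 2 _

/-! ### Fat tetrahedra and good scales -/

/-- The vertices `q` of a tetrahedron lie in `S ∩ B(q 0, d)` and the tetrahedron has volume
comparable to `d ^ 3`. -/
def IsFat (S : Set E3) (d : ℝ) (q : Fin 4 → E3) : Prop :=
  (∀ i, q i ∈ S ∩ Metric.closedBall (q 0) d) ∧
    (d / 4) ^ 3 ≤ |triple (q 1 - q 0) (q 2 - q 0) (q 3 - q 0)|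

/-- A scale `d` at which `x` is a vertex of a fat tetrahedron while `S` has large area in all
smaller balls about `x`. -/
def IsGoodScale (S : Set E3) (x : E3) (d : ℝ) : Prop :=
  0 < d ∧ (∀ r, 0 < r → r ≤ d → ENNReal.ofReal (r ^ 2 / 16) ≤ μHE[2] (S ∩ Metric.closedBall x r)) ∧
    ∃ q : Fin 4 → E3, q 0 = x ∧ IsFat S d q

/-- Points of the boundary of a bounded set at which the two-sided cone condition holds have a
good scale. -/
lemma exists_isGoodScale {U : Set E3} (hUb : Bornology.IsBounded U) {x v : E3} {δ : ℝ}
    (hx : x ∈ frontier U) (hv : ‖v‖ = 1) (hδ : 0 < δ)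
    (hU : Metric.closedBall x δ ∩ (x +ᵥ conePlus (Real.pi / 4) v) ⊆ U ∪ {x})
    (hU' : Metric.closedBall x δ ∩ (x +ᵥ coneMinus (Real.pi / 4) v) ⊆ (closure U)ᶜ ∪ {x}) :
    ∃ d, IsGoodScale (frontier U) x d := by
  by_contra! hno
  -- The area bound is carried up to twice the separated scale, as the doubled scale is the
  -- candidate good scale when flatness fails.
  have key : ∀ k : ℕ, (∃ n : E3, ‖n‖ = 1 ∧ Separated U x (2 ^ k * δ) n) ∧
      ∀ r, 0 < r → r ≤ 2 * (2 ^ k * δ) →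
        ENNReal.ofReal (r ^ 2 / 16) ≤ μHE[2] (frontier U ∩ Metric.closedBall x r) := by
    have step : ∀ ρ, 0 < ρ → (∃ n : E3, ‖n‖ = 1 ∧ Separated U x ρ n) → ∀ r, ρ ≤ r → r ≤ 2 * ρ →
        ENNReal.ofReal (r ^ 2 / 16) ≤ μHE[2] (frontier U ∩ Metric.closedBall x r) := by
      rintro ρ hρ ⟨n, hn, hsep⟩ r hr1 hr2
      calc ENNReal.ofReal (r ^ 2 / 16) ≤ ENNReal.ofReal (ρ ^ 2 / 4) :=
            ENNReal.ofReal_le_ofReal (by nlinarith)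
        _ ≤ _ := hsep.le_measure hρ hn
        _ ≤ _ := by gcongr
    intro k
    induction k with
    | zero =>
      have hsep : ∀ r, 0 < r → r ≤ δ → ∃ n : E3, ‖n‖ = 1 ∧ Separated U x r n :=
        fun r hr hrδ => ⟨v, hv, separated_of_cones hU hU' hr hrδ⟩
      rw [pow_zero, one_mul]
      refine ⟨hsep δ hδ le_rfl, fun r hr hr2 => ?_⟩
      rcases le_total r δ with h | h
      · exact step r hr (hsep r hr h) r le_rfl (by linarith)
      · exact step δ hδ (hsep δ hδ le_rfl) r h hr2
    | succ k ih =>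
      obtain ⟨⟨n, hn, hsep⟩, hm⟩ := ih
      have hρ : 0 < 2 ^ k * δ := by positivity
      have e : (2 : ℝ) ^ (k + 1) * δ = 2 * (2 ^ k * δ) := by ring
      rw [e]
      have hsep' : ∃ m : E3, ‖m‖ = 1 ∧ Separated U x (2 * (2 ^ k * δ)) m := by
        apply hsep.double hρ hn
        intro a ha b hb c hc
        by_contra! hfat
        refine hno (2 * (2 ^ k * δ)) ⟨by positivity, hm, ![x, a, b, c], rfl, ?_, ?_⟩
        · intro i
          have hx' : x ∈ Metric.closedBall x (2 * (2 ^ k * δ)) :=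
            Metric.mem_closedBall_self (by positivity)
          fin_cases i
          · exact ⟨hx, hx'⟩
          · exact ha
          · exact hb
          · exact hc
        · refine le_trans (le_of_eq (by ring)) hfat
      refine ⟨hsep', fun r hr hr2 => ?_⟩
      rcases le_total r (2 * (2 ^ k * δ)) with h | h
      · exact hm r hr h
      · exact step _ (by positivity) hsep' r h hr2
  obtain ⟨R, hR⟩ := hUb.subset_closedBall x
  obtain ⟨k, hk⟩ := pow_unbounded_of_one_lt (R / δ) (one_lt_two (α := ℝ))
  obtain ⟨⟨n, hn, hsep⟩, -⟩ := key k
  have := hsep.le_of_subset_closedBall (by positivity) hn hR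
  rw [div_lt_iff₀ hδ] at hk
  linarith

/-! ### Curvature near a fat tetrahedron -/

/-- The scale of a fat tetrahedron is at most four times the diameter of the ambient set. -/
lemma IsFat.le_diam {S : Set E3} {d : ℝ} {q : Fin 4 → E3} (hq : IsFat S d q)
    (hS : Bornology.IsBounded S) : d ≤ 4 * Metric.diam S := by
  have h : ∀ i, ‖q i - q 0‖ ≤ Metric.diam S := fun i => by
    rw [← dist_eq_norm]
    exact Metric.dist_le_diam_of_mem hS (hq.1 i).1 (hq.1 0).1
  have h1 : (d / 4) ^ 3 ≤ Metric.diam S ^ 3 := by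
    calc (d / 4) ^ 3 ≤ _ := hq.2
      _ ≤ _ := abs_triple_le _ _ _
      _ ≤ Metric.diam S * Metric.diam S * Metric.diam S := by gcongr <;> exact h _
      _ = _ := by ring
  have := (Odd.strictMono_pow (by decide : Odd 3)).le_iff_le.1 h1
  linarith

/-- The perturbation costs at most `3 * (2 * d) ^ 2 * (d / 2048)`, which is less than half of `d ^ 3
/ 64`. -/
lemma IsFat.nearby {S : Set E3} {d : ℝ} (hd : 0 < d) {q T : Fin 4 → E3} (hq : IsFat S d q)
    (hT : ∀ i, dist (T i) (q i) ≤ d / 4096) :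
    d ^ 3 / 128 ≤ |triple (T 1 - T 0) (T 2 - T 0) (T 3 - T 0)| := by
  have h1 : ∀ i, ‖q i - q 0‖ ≤ d := fun i => by
    simpa [dist_eq_norm] using (hq.1 i).2
  have h2 : ∀ i, ‖(q i - q 0) - (T i - T 0)‖ ≤ d / 2048 := fun i => by
    have e : (q i - q 0) - (T i - T 0) = (T 0 - q 0) - (T i - q i) := by abel
    rw [e]
    refine (norm_sub_le _ _).trans ?_
    have := hT 0
    have := hT i
    rw [dist_eq_norm] at *
    linarith
  have h3 : ∀ i, ‖T i - T 0‖ ≤ 2 * d := fun i => by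
    have := norm_sub_norm_le (T i - T 0) (q i - q 0)
    rw [norm_sub_rev (T i - T 0) (q i - q 0)] at this
    linarith [h1 i, h2 i]
  have h1' : ∀ i, ‖q i - q 0‖ ≤ 2 * d := fun i => (h1 i).trans (by linarith)
  have h4 := abs_triple_sub_triple_le (h1' 1) (h1' 2) (h3 1) (h3 3) (h2 1) (h2 2) (h2 3)
  have h5 := abs_sub_abs_le_abs_sub (triple (q 1 - q 0) (q 2 - q 0) (q 3 - q 0))
    (triple (T 1 - T 0) (T 2 - T 0) (T 3 - T 0))
  have h6 := hq.2
  have : 0 < d ^ 3 := by positivity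
  nlinarith

lemma triangleArea_le {x y z : E3} {R : ℝ} (h1 : dist y x ≤ R) (h2 : dist z x ≤ R) :
    triangleArea x y z ≤ R ^ 2 / 2 := by
  rw [dist_eq_norm] at h1 h2
  have hR : 0 ≤ R := (norm_nonneg _).trans h1
  have : ‖cross (y - x) (z - x)‖ ≤ R * R := (norm_cross_le _ _).trans (by gcongr)
  unfold triangleArea
  linarith

lemma triangleArea_nonneg (x y z : E3) : 0 ≤ triangleArea x y z := by
  unfold triangleArea; positivity

/-- Lower bound for the curvature of a fat tetrahedron. -/
lemma le_curv {T : Fin 4 → E3} {x : E3} {d : ℝ} (hd : 0 < d)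
    (hT : ∀ i, T i ∈ Metric.closedBall x (2 * d))
    (hvol : d ^ 3 / 128 ≤ |triple (T 1 - T 0) (T 2 - T 0) (T 3 - T 0)|) :
    1 / (393216 * d) ≤ curv T := by
  have hdist : ∀ i j, dist (T i) (T j) ≤ 4 * d := fun i j => by
    have h1 := hT i
    have h2 := hT j
    rw [Metric.mem_closedBall] at h1 h2
    linarith [dist_triangle_right (T i) (T j) x]
  have hne : triple (T 1 - T 0) (T 2 - T 0) (T 3 - T 0) ≠ 0 := by
    intro h
    rw [h, abs_zero] at hvol
    have : 0 < d ^ 3 := by positivity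
    linarith
  have harea : tetraArea T ≤ 32 * d ^ 2 := by
    have h1 := triangleArea_le (hdist 1 0) (hdist 2 0)
    have h2 := triangleArea_le (hdist 1 0) (hdist 3 0)
    have h3 := triangleArea_le (hdist 2 0) (hdist 3 0)
    have h4 := triangleArea_le (hdist 2 1) (hdist 3 1)
    unfold tetraArea
    linarith
  have harea0 : 0 < tetraArea T := by
    have h1 : 0 < triangleArea (T 0) (T 1) (T 2) := by
      have : cross (T 1 - T 0) (T 2 - T 0) ≠ 0 := by
        intro h
        rw [triple, h, inner_zero_right] at hne
        exact hne rfl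
      unfold triangleArea
      have := norm_pos_iff.2 this
      linarith
    have h2 := triangleArea_nonneg (T 0) (T 1) (T 3)
    have h3 := triangleArea_nonneg (T 0) (T 2) (T 3)
    have h4 := triangleArea_nonneg (T 1) (T 2) (T 3)
    unfold tetraArea
    linarith
  have hdiam : Metric.diam (Set.range T) ≤ 4 * d := by
    apply Metric.diam_le_of_forall_dist_le (by positivity)
    rintro _ ⟨i, rfl⟩ _ ⟨j, rfl⟩
    exact hdist i j
  have hdiam0 : 0 < Metric.diam (Set.range T) := by
    have h1 : T 1 ≠ T 0 := by
      intro h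
      apply hne
      have := abs_triple_le (T 1 - T 0) (T 2 - T 0) (T 3 - T 0)
      rw [h, sub_self, norm_zero, zero_mul, zero_mul] at this
      rw [h, sub_self]
      exact abs_nonpos_iff.1 this
    exact (dist_pos.2 h1).trans_le (Metric.dist_le_diam_of_mem (Set.finite_range T).isBounded
      (Set.mem_range_self _) (Set.mem_range_self _))
  have hV : d ^ 3 / 768 ≤ tetraVolume T := by
    have : tetraVolume T = |triple (T 1 - T 0) (T 2 - T 0) (T 3 - T 0)| / 6 := rfl
    rw [this]
    linarith
  rw [curv, if_neg (not_coplanar_of_triple_ne_zero hne)]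
  calc 1 / (393216 * d) = (d ^ 3 / 768) / (32 * d ^ 2 * (4 * d) ^ 2) := by
        field_simp; norm_num
    _ ≤ tetraVolume T / (tetraArea T * Metric.diam (Set.range T) ^ 2) := by
        have : 0 ≤ tetraVolume T := le_trans (by positivity) hV
        gcongr

/-! ### Energy estimates -/

open MeasureTheory Filter Topology

instance nullSingletonClass_euclideanHausdorffMeasure_two_restrict (S : Set E3) :
    NullSingletonClass ((μHE[2] : Measure E3).restrict S) := by
  refine ⟨fun x => le_antisymm ((Measure.restrict_apply_le _ _).trans ?_) zero_le⟩
  have h : (μH[(2 : ℕ)] : Measure E3) {x} = 0 :=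
    (Measure.nullSingletonClass_hausdorff E3 (by norm_num)).measure_singleton x
  rw [Measure.euclideanHausdorffMeasure_def, Measure.smul_apply, h, smul_zero]

/-- The fourfold product measure gives no mass to the set where the first two points agree. -/
lemma pi_diagonal_eq_zero (ν : Measure E3) [IsFiniteMeasure ν] [NullSingletonClass ν] :
    Measure.pi (fun _ : Fin 4 => ν) {T | T 0 = T 1} = 0 := by
  have hmp := measurePreserving_piFinSuccAbove (fun _ : Fin 4 => ν) 0
  have hms : MeasurableSet {p : E3 × (Fin 3 → E3) | p.1 = p.2 0} :=
    measurableSet_eq_fun measurable_fst ((measurable_pi_apply 0).comp measurable_snd)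
  have hpre : {T : Fin 4 → E3 | T 0 = T 1} =
      MeasurableEquiv.piFinSuccAbove (fun _ : Fin 4 => E3) 0 ⁻¹'
        {p : E3 × (Fin 3 → E3) | p.1 = p.2 0} := rfl
  rw [hpre, hmp.measure_preimage hms.nullMeasurableSet, Measure.measure_prod_null hms]
  refine ae_of_all _ fun u => ?_
  have e : Prod.mk u ⁻¹' {p : E3 × (Fin 3 → E3) | p.1 = p.2 0} = {f | f 0 = u} := by
    ext f
    exact eq_comm
  change Measure.pi (fun _ : Fin 3 => ν) (Prod.mk u ⁻¹' {p : E3 × (Fin 3 → E3) | p.1 = p.2 0}) = 0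
  rw [e]
  exact Measure.pi_hyperplane (fun _ : Fin 3 => ν) 0 u

/-- Continuity from above at the null diagonal. Small tetrahedra lie in these sets, which makes
absolute continuity applicable. -/
lemma tendsto_pi_near_diagonal (ν : Measure E3) [IsFiniteMeasure ν] [NullSingletonClass ν] :
    Tendsto (fun ε : ℝ => Measure.pi (fun _ : Fin 4 => ν) {T | dist (T 0) (T 1) ≤ ε})
      (𝓝[>] 0) (𝓝 0) := by
  have hmeas : Measurable fun T : Fin 4 → E3 => dist (T 0) (T 1) :=
    (measurable_pi_apply 0).dist (measurable_pi_apply 1)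
  have h := tendsto_measure_biInter_gt (μ := Measure.pi (fun _ : Fin 4 => ν))
    (s := fun ε : ℝ => {T | dist (T 0) (T 1) ≤ ε}) (a := 0)
    (fun ε _ => (measurableSet_le hmeas measurable_const).nullMeasurableSet)
    (fun i j _ hij T hT => le_trans hT hij) ⟨1, one_pos, measure_ne_top _ _⟩
  have hI : ⋂ ε > (0 : ℝ), {T : Fin 4 → E3 | dist (T 0) (T 1) ≤ ε} = {T | T 0 = T 1} := by
    ext T
    simp only [Set.mem_iInter]
    refine ⟨fun hT => ?_, fun hT ε hε => ?_⟩
    · exact dist_le_zero.1 (le_of_forall_gt_imp_ge_of_dense fun ε hε => hT ε hε)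
    · change dist (T 0) (T 1) ≤ ε
      rw [show T 0 = T 1 from hT, dist_self]
      exact le_of_lt hε
  rw [hI, pi_diagonal_eq_zero] at h
  exact h

/-- A fat tetrahedron of size `d` with area at least `k * d ^ 2` near each of its vertices
contributes a fixed amount to the curvature energy. -/
lemma IsFat.le_setLIntegral {S : Set E3} [IsFiniteMeasure ((μHE[2] : Measure E3).restrict S)]
    {d k : ℝ} (hd : 0 < d) (hk : 0 ≤ k) {q p : Fin 4 → E3} (hq : IsFat S d q)
    (hp : ∀ i, dist (p i) (q i) ≤ d / 8192)
    (hmass : ∀ i, ENNReal.ofReal (k * d ^ 2) ≤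
      μHE[2] (S ∩ Metric.closedBall (p i) (d / 8192))) :
    ENNReal.ofReal (k ^ 4 / 393216 ^ 8) ≤
      ∫⁻ T in {T : Fin 4 → E3 | dist (T 0) (T 1) ≤ 4 * d}, ENNReal.ofReal (curv T ^ (8 : ℝ))
        ∂(Measure.pi fun _ : Fin 4 => (μHE[2] : Measure E3).restrict S) := by
  -- The balls are centred at `p`, not `q`, so that area bounds on a dense set suffice; the two
  -- errors `d / 8192` add up to `d / 4096`.
  set E : Set (Fin 4 → E3) := Set.univ.pi fun i => Metric.closedBall (p i) (d / 8192) with hE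
  have hEm : MeasurableSet E :=
    MeasurableSet.univ_pi fun i => Metric.isClosed_closedBall.measurableSet
  have hEq : ∀ T ∈ E, ∀ i, dist (T i) (q i) ≤ d / 4096 := fun T hT i => by
    have h1 : dist (T i) (p i) ≤ d / 8192 := hT i (Set.mem_univ i)
    linarith [dist_triangle (T i) (p i) (q i), hp i]
  have hE2 : ∀ T ∈ E, ∀ i, T i ∈ Metric.closedBall (q 0) (2 * d) := fun T hT i => by
    have h1 := hEq T hT i
    have h2 := Metric.mem_closedBall.1 (hq.1 i).2
    rw [Metric.mem_closedBall]
    linarith [dist_triangle (T i) (q i) (q 0)]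
  have hsub : E ⊆ {T : Fin 4 → E3 | dist (T 0) (T 1) ≤ 4 * d} := fun T hT => by
    have h0 := Metric.mem_closedBall.1 (hE2 T hT 0)
    have h1 := Metric.mem_closedBall.1 (hE2 T hT 1)
    change dist (T 0) (T 1) ≤ 4 * d
    linarith [dist_triangle_right (T 0) (T 1) (q 0)]
  have hcurv : ∀ T ∈ E, ENNReal.ofReal ((1 / (393216 * d)) ^ 8) ≤
      ENNReal.ofReal (curv T ^ (8 : ℝ)) := fun T hT => by
    have h := le_curv hd (hE2 T hT) (hq.nearby hd (hEq T hT))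
    rw [show (8 : ℝ) = ((8 : ℕ) : ℝ) by norm_num, Real.rpow_natCast]
    gcongr
  have hmeasE : ENNReal.ofReal ((k * d ^ 2) ^ 4) ≤
      (Measure.pi fun _ : Fin 4 => (μHE[2] : Measure E3).restrict S) E := by
    rw [hE, Measure.pi_pi, ENNReal.ofReal_pow (by positivity)]
    calc ENNReal.ofReal (k * d ^ 2) ^ 4 = ∏ _i : Fin 4, ENNReal.ofReal (k * d ^ 2) := by simp
      _ ≤ _ := by
        refine Finset.prod_le_prod' fun i _ => ?_
        rw [Measure.restrict_apply Metric.isClosed_closedBall.measurableSet, Set.inter_comm]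
        exact hmass i
  calc ENNReal.ofReal (k ^ 4 / 393216 ^ 8)
      = ENNReal.ofReal ((1 / (393216 * d)) ^ 8) * ENNReal.ofReal ((k * d ^ 2) ^ 4) := by
        rw [← ENNReal.ofReal_mul (by positivity)]
        congr 1
        field_simp
    _ ≤ ENNReal.ofReal ((1 / (393216 * d)) ^ 8) *
        (Measure.pi fun _ : Fin 4 => (μHE[2] : Measure E3).restrict S) E := by gcongr
    _ = ∫⁻ _ in E, ENNReal.ofReal ((1 / (393216 * d)) ^ 8)
        ∂(Measure.pi fun _ : Fin 4 => (μHE[2] : Measure E3).restrict S) := by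
        rw [setLIntegral_const]
    _ ≤ ∫⁻ T in E, ENNReal.ofReal (curv T ^ (8 : ℝ))
        ∂(Measure.pi fun _ : Fin 4 => (μHE[2] : Measure E3).restrict S) :=
        setLIntegral_mono' hEm hcurv
    _ ≤ _ := lintegral_mono_set hsub

/-- Lower regularity and fat tetrahedra at arbitrarily small scales force infinite energy. -/
lemma mengerEnergy_eq_top {S : Set E3} [IsFiniteMeasure ((μHE[2] : Measure E3).restrict S)]
    (hb : Bornology.IsBounded S) (hreg : LowerRegular S)
    (hsmall : ∀ ε > 0, ∃ d, 0 < d ∧ d < ε ∧ ∃ q, IsFat S d q) : mengerEnergy 8 S = ⊤ := by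
  by_contra hfin
  obtain ⟨K, hK, hreg⟩ := hreg
  set k : ℝ := K⁻¹ * (1 / 8192) ^ 2 with hkdef
  have hk : 0 < k := by positivity
  have hlim := tendsto_setLIntegral_zero hfin
    (tendsto_pi_near_diagonal ((μHE[2] : Measure E3).restrict S))
  have hpos : (0 : ENNReal) < ENNReal.ofReal (k ^ 4 / 393216 ^ 8) :=
    ENNReal.ofReal_pos.2 (by positivity)
  obtain ⟨ε, hε, hε0⟩ := ((hlim.eventually (gt_mem_nhds hpos)).and self_mem_nhdsWithin).exists
  have hε0 : 0 < ε := hε0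
  obtain ⟨d, hd, hdε, q, hq⟩ := hsmall (ε / 4) (by positivity)
  -- This makes `d / 8192` an admissible radius in the regularity condition.
  have hdiam := hq.le_diam hb
  have h := hq.le_setLIntegral hd hk.le (p := q) (fun i => by rw [dist_self]; positivity) (fun i => by
    refine le_trans (le_of_eq ?_) (hreg (q i) (hq.1 i).1 (d / 8192) (by positivity) (by linarith)).2
    rw [hkdef]
    congr 1
    ring)
  refine absurd (h.trans (lintegral_mono_set ?_)) (not_le.2 hε)
  intro T hT
  exact le_trans hT (by linarith : 4 * d ≤ ε)

/-- Surfaces with good scales on a dense set have energy bounded below by an absolute constant. -/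
lemma le_mengerEnergy {S D : Set E3} [IsFiniteMeasure ((μHE[2] : Measure E3).restrict S)]
    (hb : Bornology.IsBounded S) (hreg : LowerRegular S) (hD : D.Nonempty) (hSD : S ⊆ closure D)
    (hgood : ∀ x ∈ D, ∃ d, IsGoodScale S x d) :
    ENNReal.ofReal (((1 / 8192) ^ 2 / 16) ^ 4 / 393216 ^ 8) ≤ mengerEnergy 8 S := by
  by_cases hsmall : ∀ ε > 0, ∃ d, 0 < d ∧ d < ε ∧ ∃ q, IsFat S d q
  · rw [mengerEnergy_eq_top hb hreg hsmall]
    exact le_top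
  push Not at hsmall
  obtain ⟨ε, hε, hbelow⟩ := hsmall
  -- The infimum of good scales is at least `ε > 0` but need not be attained; a scale below twice
  -- the infimum is enough.
  obtain ⟨d, ⟨x, hx, hxd⟩, hmin⟩ : ∃ d, (∃ x ∈ D, IsGoodScale S x d) ∧
      ∀ d' x', x' ∈ D → IsGoodScale S x' d' → d / 2 ≤ d' := by
    set G := {d | ∃ x ∈ D, IsGoodScale S x d} with hG
    have hGε : ∀ d ∈ G, ε ≤ d := by
      rintro d ⟨x, -, hd, -, q, -, hq⟩
      by_contra! h
      exact hbelow d hd h q hq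
    have hGne : G.Nonempty := by
      obtain ⟨x, hx⟩ := hD
      obtain ⟨d, hd⟩ := hgood x hx
      exact ⟨d, x, hx, hd⟩
    have hinf : ε ≤ sInf G := le_csInf hGne hGε
    obtain ⟨d, hdG, hd⟩ := exists_lt_of_csInf_lt hGne (show sInf G < 2 * sInf G by linarith)
    refine ⟨d, hdG, fun d' x' hx' hd' => ?_⟩
    have := csInf_le ⟨ε, hGε⟩ (show d' ∈ G from ⟨x', hx', hd'⟩)
    linarith
  obtain ⟨hd, -, q, -, hq⟩ := hxd
  have hp : ∀ i, ∃ p ∈ D, dist (q i) p < d / 8192 := fun i =>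
    Metric.mem_closure_iff.1 (hSD (hq.1 i).1) _ (by positivity)
  choose p hpD hpq using hp
  refine (hq.le_setLIntegral hd (by positivity) (p := p)
    (fun i => by rw [dist_comm]; exact (hpq i).le) (fun i => ?_)).trans
    (setLIntegral_le_lintegral _ _)
  obtain ⟨d', hd'⟩ := hgood (p i) (hpD i)
  have hle := hmin d' _ (hpD i) hd'
  refine le_trans (le_of_eq ?_) (hd'.2.1 (d / 8192) (by positivity) (by linarith))
  congr 1
  ring

end MengerSurface

end

theorem theorem3p2 :
    ∃ γ₀ : ℝ, 0 < γ₀ ∧ ∀ S : Set MengerSurface.E3, MengerSurface.IsAdmissible S →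
      ENNReal.ofReal γ₀ < MengerSurface.mengerEnergy 8 S := by
  refine ⟨((1 / 8192) ^ 2 / 16) ^ 4 / 393216 ^ 8 / 2, by positivity, fun S hS => ?_⟩
  obtain ⟨hcomp, hconn, U, -, -, hUb, rfl, hreg, D, hDS, hSD, hcone⟩ := hS
  have hgood : ∀ x ∈ D, ∃ d, MengerSurface.IsGoodScale (frontier U) x d := fun x hx => by
    obtain ⟨v, hv, δ, hδ, h1, h2⟩ := hcone x hx
    exact MengerSurface.exists_isGoodScale hUb (hDS hx) hv hδ h1 h2
  have hD : D.Nonempty := closure_nonempty_iff.1 (hconn.nonempty.mono hSD)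
  -- A fat tetrahedron forces positive diameter, so regularity at that radius bounds the whole area.
  have hfin : MeasureTheory.IsFiniteMeasure
      ((μHE[2] : MeasureTheory.Measure MengerSurface.E3).restrict (frontier U)) := by
    obtain ⟨x, hx⟩ := hD
    obtain ⟨d, hd, -, q, -, hq⟩ := hgood x hx
    have hdiam : 0 < Metric.diam (frontier U) := by linarith [hq.le_diam hcomp.isBounded]
    obtain ⟨K, -, hK⟩ := hreg
    have h := (hK x (hDS hx) _ hdiam le_rfl).1
    have hsub : frontier U ⊆ Metric.closedBall x (Metric.diam (frontier U)) :=
      fun y hy => Metric.dist_le_diam_of_mem hcomp.isBounded hy (hDS hx)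
    rw [Set.inter_eq_left.2 hsub] at h
    exact ⟨by rwa [MeasureTheory.Measure.restrict_apply_univ]⟩
  refine lt_of_lt_of_le ?_ (MengerSurface.le_mengerEnergy hcomp.isBounded hreg hD hSD hgood)
  exact (ENNReal.ofReal_lt_ofReal_iff (by positivity)).2 (half_lt_self (by positivity))
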